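/- Let $0<\delta\le 1$, $\alpha:=\lceil 16+15\delta\rceil$, let $k$ be a natural number, let $(\Omega,P)$ be a probability space and $\Phi=\Phi(\omega)$, $\omega\in\Omega$, a random real $n\times N$ matrix. Write $\Sigma_k\subset\mathbb R^N$ for the vectors with at most $k$ nonzero entries and $\sigma_k(x)_2:=\min_{z\in\Sigma_k}\|x-z\|_2$. A matrix $A$ has the restricted isometry property (RIP) of order $k$ with constant $\delta_k\in[0,1)$ if $(1-\delta_k)\|z\|_2^2\le\|Az\|_2^2\le(1+\delta_k)\|z\|_2^2$ for all $z\in\Sigma_k$. Assume that, for some real $\varepsilon$ and $C$: (i) there is an event $\Omega_0$ with $P(\Omega_0)\ge 1-\varepsilon$ such that for every $\omega\in\Omega_0$ the matrix $\Phi(\omega)$ has the RIP of order $k$ with a constant $\delta_k$ and of order $\alpha k$ with a constant $\delta_{\alpha k}$ such that $\delta_k+(1+\delta)\delta_{\alpha k}\le\delta$; (ii) $\Phi$ has the boundedness property with constant $C$ and probability $1-\varepsilon$: for each $x\in\mathbb R^N$ there is an event $\Omega_0(x)$ with $P(\Omega_0(x))\ge 1-\varepsilon$ such that $\|\Phi(\omega)x\|_2^2\le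 C\|x\|_2^2$ for all $\omega\in\Omega_0(x)$. Then for each $x\in\mathbb R^N$ there is an event $\Omega(x)$ with $P(\Omega(x))\ge 1-2\varepsilon$ such that for all $\omega\in\Omega(x)$, with $\Phi=\Phi(\omega)$, $$\|x^*-x\|_2\le C_3\,\sigma_k(x)_2,\qquad C_3=1+\sqrt{C(1+\delta)}\,\bigl(1+\sqrt{11+20\delta}\bigr),$$ where $x^*$ is any output of orthogonal matching pursuit $\mathrm{OMP}_M(y)$ with $M=(\alpha-1)k$ and $y=\Phi x$. Here $\mathrm{OMP}_M(y)$ starts with $\Lambda^0=\emptyset$, $c^0=0$, and for $\ell=0,\dots,M-1$ puts $r^\ell=y-\Phi c^\ell$, chooses $j$ maximizing $|(\Phi^Tr^\ell)_j|$, sets $\Lambda^{\ell+1}=\Lambda^\ell\cup\{j\}$, and takes for $c^{\ell+1}$ a minimizer of $\|y-\Phi z\|_2$ over all $z$ supported in $\Lambda^{\ell+1}$; the output is $c^M$ (ties are broken arbitrarily). That is, $(\Phi,\mathrm{OMP}_{(\alpha-1)k})$ is $(2,2)$ instance optimal in probability of order $k$ with constant $C_3$. -/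

import Mathlib

/-- The image `A z`, as a vector of the Euclidean space `ℝⁿ`. -/
noncomputable def applyMat {n N : ℕ} (A : Matrix (Fin n) (Fin N) ℝ)
    (z : EuclideanSpace ℝ (Fin N)) : EuclideanSpace ℝ (Fin n) :=
  WithLp.toLp 2 (A.mulVec (WithLp.ofLp z))

/-- `z ∈ Σ_k`: the vector `z` has at most `k` nonzero coordinates. -/
def IsSparse {N : ℕ} (k : ℕ) (z : EuclideanSpace ℝ (Fin N)) : Prop :=
  {i : Fin N | z i ≠ 0}.ncard ≤ k

/-- The best `k`-term approximation error `σ_k(x)₂ = min {‖x - z‖₂ : z ∈ Σ_k}`. -/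
noncomputable def bestTermError {N : ℕ} (k : ℕ) (x : EuclideanSpace ℝ (Fin N)) : ℝ :=
  ⨅ z : {z : EuclideanSpace ℝ (Fin N) // IsSparse k z}, ‖x - z.1‖

/-- `A` satisfies the restricted isometry property of order `k` with constant `d`. -/
def HasRIP {n N : ℕ} (A : Matrix (Fin n) (Fin N) ℝ) (k : ℕ) (d : ℝ) : Prop :=
  0 ≤ d ∧ d < 1 ∧ ∀ z : EuclideanSpace ℝ (Fin N), IsSparse k z →
    (1 - d) * ‖z‖ ^ 2 ≤ ‖applyMat A z‖ ^ 2 ∧ ‖applyMat A z‖ ^ 2 ≤ (1 + d) * ‖z‖ ^ 2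

/-- `A` satisfies the RIP condition `δ_k + (1 + δ) δ_{αk} ≤ δ`: it has RIP constants
of the orders `k` and `α k` for which this inequality holds. -/
def RIPCondition {n N : ℕ} (A : Matrix (Fin n) (Fin N) ℝ) (k α : ℕ) (δ : ℝ) : Prop :=
  ∃ dk dαk : ℝ, HasRIP A k dk ∧ HasRIP A (α * k) dαk ∧ dk + (1 + δ) * dαk ≤ δ

/-- The random matrix `Φ` satisfies the RIP condition `δ_k + (1 + δ) δ_{αk} ≤ δ` with
probability (at least) `1 - ε`. -/
def RIPConditionWithProb {Ω : Type*} [MeasurableSpace Ω] (P : MeasureTheory.Measure Ω)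
    {n N : ℕ} (Φ : Ω → Matrix (Fin n) (Fin N) ℝ) (k α : ℕ) (δ ε : ℝ) : Prop :=
  ∃ Ω₀ : Set Ω, MeasurableSet Ω₀ ∧ 1 - ε ≤ P.real Ω₀ ∧ ∀ ω ∈ Ω₀, RIPCondition (Φ ω) k α δ

/-- The random matrix `Φ` has the boundedness property with constant `C` and probability
`1 - ε`; the event may depend on the vector. -/
def BoundednessWithProb {Ω : Type*} [MeasurableSpace Ω] (P : MeasureTheory.Measure Ω)
    {n N : ℕ} (Φ : Ω → Matrix (Fin n) (Fin N) ℝ) (C ε : ℝ) : Prop :=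
  ∀ x : EuclideanSpace ℝ (Fin N), ∃ Ω₀ : Set Ω, MeasurableSet Ω₀ ∧ 1 - ε ≤ P.real Ω₀ ∧
    ∀ ω ∈ Ω₀, ‖applyMat (Φ ω) x‖ ^ 2 ≤ C * ‖x‖ ^ 2

/-- `c` minimizes `‖y - A z‖₂` over all `z` with support in `Λ`. -/
def IsLeastSquares {n N : ℕ} (A : Matrix (Fin n) (Fin N) ℝ) (y : EuclideanSpace ℝ (Fin n))
    (Λ : Finset (Fin N)) (c : EuclideanSpace ℝ (Fin N)) : Prop :=
  (∀ i, i ∉ Λ → c i = 0) ∧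
    ∀ z : EuclideanSpace ℝ (Fin N), (∀ i, i ∉ Λ → z i = 0) →
      ‖y - applyMat A c‖ ≤ ‖y - applyMat A z‖

/-- `j` is a maximizer of `|h(j)|`. -/
def IsArgmaxAbs {N : ℕ} (h : EuclideanSpace ℝ (Fin N)) (j : Fin N) : Prop :=
  ∀ i, |h i| ≤ |h j|

/-- `OMPReach A y ℓ Λ c`: orthogonal matching pursuit with encoding matrix `A` and data `y`
can have the index set `Λ` and the iterate `c` after `ℓ` iterations. The residual is
`y - A c`; ties in the argmax (and in a least-squares problem with several minimizers)
may be broken in any way. -/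
inductive OMPReach {n N : ℕ} (A : Matrix (Fin n) (Fin N) ℝ) (y : EuclideanSpace ℝ (Fin n)) :
    ℕ → Finset (Fin N) → EuclideanSpace ℝ (Fin N) → Prop
  | init : OMPReach A y 0 ∅ 0
  | step {ℓ : ℕ} {Λ : Finset (Fin N)} {c c' : EuclideanSpace ℝ (Fin N)} {j : Fin N}
      (prev : OMPReach A y ℓ Λ c)
      (identify : IsArgmaxAbs (applyMat A.transpose (y - applyMat A c)) j)
      (update : IsLeastSquares A y (insert j Λ) c') :
      OMPReach A y (ℓ + 1) (insert j Λ) c'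

/-- `xs` is an output of `OMP_M(y)` with encoding matrix `A`. -/
def IsOMPOutput {n N : ℕ} (A : Matrix (Fin n) (Fin N) ℝ) (M : ℕ)
    (y : EuclideanSpace ℝ (Fin n)) (xs : EuclideanSpace ℝ (Fin N)) : Prop :=
  ∃ Λ : Finset (Fin N), OMPReach A y M Λ xs

/-- Least-squares minimizers exist. -/
theorem exists_isLeastSquares {n N : ℕ} (A : Matrix (Fin n) (Fin N) ℝ)
    (y : EuclideanSpace ℝ (Fin n)) (Λ : Finset (Fin N)) :
    ∃ c, IsLeastSquares A y Λ c := by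
  let L : EuclideanSpace ℝ (Fin N) →ₗ[ℝ] EuclideanSpace ℝ (Fin n) :=
    { toFun := applyMat A
      map_add' := fun u v => by ext i; simp [applyMat, Matrix.mulVec_add]
      map_smul' := fun t v => by ext i; simp [applyMat, Matrix.mulVec_smul] }
  let V : Submodule ℝ (EuclideanSpace ℝ (Fin N)) :=
    { carrier := {z | ∀ i, i ∉ Λ → z i = 0}
      add_mem' := fun {u v} hu hv i hi => by simp [hu i hi, hv i hi]
      zero_mem' := fun i _ => by simp
      smul_mem' := fun t v hv i hi => by simp [hv i hi] }
  have hcl : IsClosed ((V.map L : Submodule ℝ _) : Set (EuclideanSpace ℝ (Fin n))) :=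
    Submodule.closed_of_finiteDimensional _
  obtain ⟨w, ⟨c, hc, rfl⟩, hw⟩ := hcl.exists_infDist_eq_dist ⟨0, (V.map L).zero_mem⟩ y
  refine ⟨c, hc, fun z hz => ?_⟩
  have h1 := Metric.infDist_le_dist_of_mem (x := y)
    (show L z ∈ ((V.map L : Submodule ℝ _) : Set _) from ⟨z, hz, rfl⟩)
  rw [hw, dist_eq_norm, dist_eq_norm] at h1
  exact h1

/-- Orthogonal matching pursuit always has an output (for at least one column). -/
theorem exists_isOMPOutput {n N : ℕ} (hN : 0 < N) (A : Matrix (Fin n) (Fin N) ℝ) (M : ℕ)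
    (y : EuclideanSpace ℝ (Fin n)) : ∃ xs, IsOMPOutput A M y xs := by
  induction M with
  | zero => exact ⟨0, ∅, OMPReach.init⟩
  | succ M ih =>
    obtain ⟨c, Λ, hc⟩ := ih
    have : Nonempty (Fin N) := ⟨⟨0, hN⟩⟩
    obtain ⟨j, hj⟩ := Finite.exists_max
      (fun i => |applyMat A.transpose (y - applyMat A c) i|)
    obtain ⟨c', hc'⟩ := exists_isLeastSquares A y (insert j Λ)
    exact ⟨c', insert j Λ, OMPReach.step hc hj hc'⟩

/-! ### Coordinate algebra and best `k`-term approximation -/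

section OMP

variable {n N : ℕ}

/-! Let `z` be a best `k`-term approximation of `x`, supported in `T`. Then `y = Φ z + e` with `e =
Φ (x - z)`, and boundedness is needed only at the fixed vector `x - z`. It suffices that the final
residual is `O(‖e‖)`: the lower RIP bound on `T ∪ S M`, of size at most `α k`, turns this into a
bound on the error.

One greedy step removes at least a fraction `1 / ((1 + δ) d)` of the excess of the residual energy
over that of any sparse competitor with at most `d` nonzero entries off the current index set
(`residual_step`). The competitors keep the selected part of `z` and its 0, 1, 2, 4, … largest
missing entries. Stop at the first block after which the tail energy drops by a factor 16. The
residual is then small against the tail before that drop, so either it is already `O(‖e‖)`, or the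
iterate is so close to `z` that more than `blockSize L` missing indices were selected
(`residual_small_or_capture`). Each captured index costs at most `a = α - 1` iterations, so `a k`
iterations suffice (`residual_le`). -/

theorem applyMat_sub (A : Matrix (Fin n) (Fin N) ℝ) (u v : EuclideanSpace ℝ (Fin N)) :
    applyMat A (u - v) = applyMat A u - applyMat A v := by
  ext i; simp [applyMat, Matrix.mulVec_sub]

theorem applyMat_add (A : Matrix (Fin n) (Fin N) ℝ) (u v : EuclideanSpace ℝ (Fin N)) :
    applyMat A (u + v) = applyMat A u + applyMat A v := by
  ext i; simp [applyMat, Matrix.mulVec_add]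

theorem applyMat_smul (A : Matrix (Fin n) (Fin N) ℝ) (t : ℝ) (v : EuclideanSpace ℝ (Fin N)) :
    applyMat A (t • v) = t • applyMat A v := by
  ext i; simp [applyMat, Matrix.mulVec_smul]

theorem inner_applyMat (A : Matrix (Fin n) (Fin N) ℝ) (r : EuclideanSpace ℝ (Fin n))
    (v : EuclideanSpace ℝ (Fin N)) :
    inner ℝ r (applyMat A v) = ∑ i, applyMat A.transpose r i * v i := by
  simp only [applyMat, PiLp.inner_apply, Matrix.mulVec, dotProduct, Matrix.transpose_apply,
    RCLike.inner_apply, conj_trivial, Finset.sum_mul]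
  rw [Finset.sum_comm]
  refine Finset.sum_congr rfl fun i _ => Finset.sum_congr rfl fun j _ => by ring

theorem inner_applyMat_single (A : Matrix (Fin n) (Fin N) ℝ) (r : EuclideanSpace ℝ (Fin n))
    (j : Fin N) :
    inner ℝ r (applyMat A (EuclideanSpace.single j 1)) = applyMat A.transpose r j := by
  rw [inner_applyMat]
  simp

theorem isSparse_of_support {k : ℕ} {z : EuclideanSpace ℝ (Fin N)} (s : Finset (Fin N))
    (h : ∀ i, i ∉ s → z i = 0) (hs : s.card ≤ k) : IsSparse k z := by
  refine le_trans ?_ hs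
  rw [← Set.ncard_coe_finset]
  refine Set.ncard_le_ncard (fun i hi => ?_) s.finite_toSet
  by_contra hc
  exact hi (h i (by simpa using hc))

/-- The restriction of `z` to the coordinates in `s`. -/
noncomputable def restrictTo (s : Finset (Fin N)) (z : EuclideanSpace ℝ (Fin N)) :
    EuclideanSpace ℝ (Fin N) :=
  WithLp.toLp 2 (fun i => if i ∈ s then z i else 0)

theorem restrictTo_apply (s : Finset (Fin N)) (z : EuclideanSpace ℝ (Fin N)) (i : Fin N) :
    restrictTo s z i = if i ∈ s then z i else 0 := rfl

theorem sum_sq_le_norm_sq (s : Finset (Fin N)) (z : EuclideanSpace ℝ (Fin N)) :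
    ∑ i ∈ s, z i ^ 2 ≤ ‖z‖ ^ 2 := by
  rw [EuclideanSpace.real_norm_sq_eq]
  exact Finset.sum_le_univ_sum_of_nonneg fun i => sq_nonneg _

theorem norm_sq_eq_sum_of_support (s : Finset (Fin N)) (z : EuclideanSpace ℝ (Fin N))
    (h : ∀ i, i ∉ s → z i = 0) : ‖z‖ ^ 2 = ∑ i ∈ s, z i ^ 2 := by
  rw [EuclideanSpace.real_norm_sq_eq]
  refine (Finset.sum_subset (Finset.subset_univ s) fun i _ hi => ?_).symm
  rw [h i hi]; norm_num

/-- The best `k`-term approximation error is attained. -/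
theorem exists_best_term_approx (k : ℕ) (x : EuclideanSpace ℝ (Fin N)) :
    ∃ (T : Finset (Fin N)) (z : EuclideanSpace ℝ (Fin N)), T.card ≤ k ∧
      (∀ i, i ∉ T → z i = 0) ∧ ‖x - z‖ ≤ bestTermError k x := by
  -- Only the finitely many restrictions of `x` itself need comparing: restricting `x` to the
  -- support of a sparse `z` does at least as well as `z`.
  obtain ⟨T, hT, hmin⟩ := Finset.exists_min_image
    ((Finset.univ : Finset (Finset (Fin N))).filter fun s => s.card ≤ k)
    (fun s => ‖x - restrictTo s x‖) ⟨∅, by simp⟩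
  refine ⟨T, restrictTo T x, (Finset.mem_filter.1 hT).2,
    fun i hi => by simp [restrictTo_apply, hi], ?_⟩
  have : Nonempty {z : EuclideanSpace ℝ (Fin N) // IsSparse k z} :=
    ⟨⟨0, isSparse_of_support ∅ (by simp) (by simp)⟩⟩
  refine le_ciInf fun ⟨z, hz⟩ => ?_
  classical
  set s : Finset (Fin N) := Finset.univ.filter fun i => z i ≠ 0 with hs
  have hcard : s.card ≤ k := by
    refine le_trans (le_of_eq ?_) hz
    rw [← Set.ncard_coe_finset]
    congr 1
    ext i; simp [hs]
  refine (hmin s (by simpa using hcard)).trans ?_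
  refine le_of_sq_le_sq ?_ (norm_nonneg _)
  rw [EuclideanSpace.real_norm_sq_eq, EuclideanSpace.real_norm_sq_eq]
  refine Finset.sum_le_sum fun i _ => ?_
  by_cases hi : z i = 0
  · simp [restrictTo_apply, hs, hi]
  · simp [restrictTo_apply, hs, hi, sq_nonneg]

/-! ### Least squares and the energy drop of one greedy step -/

theorem norm_sub_smul_sq {E : Type*} [NormedAddCommGroup E] [InnerProductSpace ℝ E]
    (r v : E) (t : ℝ) :
    ‖r - t • v‖ ^ 2 = ‖r‖ ^ 2 - 2 * t * inner ℝ r v + t ^ 2 * ‖v‖ ^ 2 := by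
  rw [norm_sub_sq_real, real_inner_smul_right, norm_smul, mul_pow, Real.norm_eq_abs, sq_abs]
  ring

/-- The residual of a least-squares solution is orthogonal to the selected columns. -/
theorem IsLeastSquares.transpose_residual_eq_zero {A : Matrix (Fin n) (Fin N) ℝ}
    {y : EuclideanSpace ℝ (Fin n)} {Λ : Finset (Fin N)} {c : EuclideanSpace ℝ (Fin N)}
    (h : IsLeastSquares A y Λ c) {i : Fin N} (hi : i ∈ Λ) :
    applyMat A.transpose (y - applyMat A c) i = 0 := by
  set r := y - applyMat A c with hr
  set v := applyMat A (EuclideanSpace.single i (1 : ℝ)) with hv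
  rw [← inner_applyMat_single, ← hv]
  set a : ℝ := inner ℝ r v
  have key (t : ℝ) : 0 ≤ -(2 * t * a) + t ^ 2 * ‖v‖ ^ 2 := by
    have h1 := h.2 (c + t • EuclideanSpace.single i (1 : ℝ)) (fun l hl => by
      have : l ≠ i := fun hc => hl (hc ▸ hi)
      simp [h.1 l hl, this])
    rw [applyMat_add, applyMat_smul, ← hv, ← sub_sub, ← hr] at h1
    have h2 := pow_le_pow_left₀ (norm_nonneg _) h1 2
    rw [norm_sub_smul_sq] at h2
    linarith
  have hb : 0 ≤ ‖v‖ ^ 2 := sq_nonneg _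
  set b := ‖v‖ ^ 2
  -- The `+ 1` keeps the denominator positive when the column vanishes.
  have h1 := key (a / (b + 1))
  have h2 : -(2 * (a / (b + 1)) * a) + (a / (b + 1)) ^ 2 * b
      = -(a ^ 2 * (b + 2)) / (b + 1) ^ 2 := by
    field_simp
    ring
  rw [h2, le_div_iff₀ (by positivity)] at h1
  have h3 : a ^ 2 ≤ 0 := by nlinarith [sq_nonneg a]
  exact pow_eq_zero_iff two_ne_zero |>.1 (le_antisymm h3 (sq_nonneg _))

theorem IsLeastSquares.residual_antitone {A : Matrix (Fin n) (Fin N) ℝ}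
    {y : EuclideanSpace ℝ (Fin n)} {Λ Λ' : Finset (Fin N)} {c c' : EuclideanSpace ℝ (Fin N)}
    (h : IsLeastSquares A y Λ c) (h' : IsLeastSquares A y Λ' c') (hs : Λ ⊆ Λ') :
    ‖y - applyMat A c'‖ ^ 2 ≤ ‖y - applyMat A c‖ ^ 2 :=
  pow_le_pow_left₀ (norm_nonneg _) (h'.2 c fun i hi => h.1 i fun hc => hi (hs hc)) 2

/-- The reduction of the residual energy in one step of orthogonal matching pursuit, measured
against a competitor `w` with at most `d` nonzero coordinates outside the current index set. -/
theorem residual_step {A : Matrix (Fin n) (Fin N) ℝ}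
    {y : EuclideanSpace ℝ (Fin n)} {Λ F : Finset (Fin N)} {c c' w : EuclideanSpace ℝ (Fin N)}
    {j : Fin N} {D U d : ℝ} (hD : 0 < D) (hU : 0 < U) (hd : 0 < d)
    (hlow : D * ‖w - c‖ ^ 2 ≤ ‖applyMat A (w - c)‖ ^ 2)
    (hcol : ‖applyMat A (EuclideanSpace.single j (1 : ℝ))‖ ^ 2 ≤ U)
    (hc : IsLeastSquares A y Λ c)
    (hj : IsArgmaxAbs (applyMat A.transpose (y - applyMat A c)) j)
    (hc' : IsLeastSquares A y (insert j Λ) c')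
    (hF : ∀ i, i ∉ Λ → i ∉ F → w i = 0) (hcard : (F.card : ℝ) ≤ d) :
    D * (‖y - applyMat A c‖ ^ 2 - ‖y - applyMat A w‖ ^ 2) ≤
      U * d * (‖y - applyMat A c‖ ^ 2 - ‖y - applyMat A c'‖ ^ 2) := by
  set r := y - applyMat A c with hr
  set h := applyMat A.transpose r with hh
  set u := w - c with hu
  set a : ℝ := inner ℝ r (applyMat A u) with ha
  have hwr : y - applyMat A w = r - applyMat A u := by
    rw [hr, hu, applyMat_sub]; abel
  have hq : ‖y - applyMat A w‖ ^ 2 = ‖r‖ ^ 2 - 2 * a + ‖applyMat A u‖ ^ 2 := by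
    rw [hwr, norm_sub_sq_real]
  -- Indices in `Λ` drop out by orthogonality of the residual; off `Λ ∪ F` both `w` and `c` vanish.
  have haF : a = ∑ i ∈ F, h i * u i := by
    rw [ha, inner_applyMat]
    refine (Finset.sum_subset (Finset.subset_univ F) fun i _ hi => ?_).symm
    by_cases hiΛ : i ∈ Λ
    · rw [hc.transpose_residual_eq_zero hiΛ, zero_mul]
    · simp [hu, hF i hiΛ hi, hc.1 i hiΛ]
  have ha2 : a ^ 2 ≤ d * h j ^ 2 * ‖u‖ ^ 2 := by
    rw [haF]
    refine (Finset.sum_mul_sq_le_sq_mul_sq F _ _).trans ?_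
    refine mul_le_mul ?_ (sum_sq_le_norm_sq F u) (Finset.sum_nonneg fun _ _ => sq_nonneg _)
      (by positivity)
    calc ∑ i ∈ F, h i ^ 2 ≤ ∑ _i ∈ F, h j ^ 2 :=
          Finset.sum_le_sum fun i _ => sq_le_sq.2 (hj i)
      _ = F.card * h j ^ 2 := by simp
      _ ≤ d * h j ^ 2 := by gcongr
  have hgap : D * (‖r‖ ^ 2 - ‖y - applyMat A w‖ ^ 2) ≤ d * h j ^ 2 := by
    rw [hq]
    rcases (sq_nonneg ‖u‖).eq_or_lt with hX | hX
    · rw [← hX, mul_zero] at ha2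
      have ha0 : a = 0 := pow_eq_zero_iff two_ne_zero |>.1 (le_antisymm ha2 (sq_nonneg _))
      rw [ha0]
      have : 0 ≤ D * ‖applyMat A u‖ ^ 2 := by positivity
      have : 0 ≤ d * h j ^ 2 := by positivity
      linarith
    · set X := ‖u‖ ^ 2
      have h1 : D * (‖r‖ ^ 2 - (‖r‖ ^ 2 - 2 * a + ‖applyMat A u‖ ^ 2))
          ≤ 2 * a * D - D ^ 2 * X := by nlinarith
      -- Completing the square: `2 a D X - D² X² ≤ a²`, and `a²` is controlled by `ha2`.
      refine h1.trans (le_of_mul_le_mul_right ?_ hX)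
      nlinarith [sq_nonneg (a - D * X)]
  have hdrop : h j ^ 2 ≤ U * (‖r‖ ^ 2 - ‖y - applyMat A c'‖ ^ 2) := by
    -- Line search along column `j`, with `U` in place of its squared norm.
    set t := h j / U with ht
    have h1 := hc'.2 (c + t • EuclideanSpace.single j (1 : ℝ)) (fun l hl => by
      rw [Finset.mem_insert, not_or] at hl
      simp [hc.1 l hl.2, hl.1])
    rw [applyMat_add, applyMat_smul, ← sub_sub, ← hr] at h1
    have h2 := pow_le_pow_left₀ (norm_nonneg _) h1 2
    rw [norm_sub_smul_sq, inner_applyMat_single, ← hh] at h2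
    have h3 := mul_le_mul_of_nonneg_left hcol (sq_nonneg t)
    have h4 : t * U = h j := by rw [ht]; field_simp
    have h5 : t ^ 2 * U = t * h j := by rw [← h4]; ring
    have h6 : h j ^ 2 = U * (t * h j) := by rw [← h4]; ring
    rw [h6]
    exact mul_le_mul_of_nonneg_left (by linarith) hU.le
  calc _ ≤ d * h j ^ 2 := hgap
    _ ≤ d * (U * (‖r‖ ^ 2 - ‖y - applyMat A c'‖ ^ 2)) :=
        mul_le_mul_of_nonneg_left hdrop hd.le
    _ = _ := by ring

/-! ### Runs and geometric decay of the residual -/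

/-- A run of `M` iterations of orthogonal matching pursuit, with the index sets `S ℓ` and the
iterates `c ℓ`. -/
structure IsOMPRun (A : Matrix (Fin n) (Fin N) ℝ) (y : EuclideanSpace ℝ (Fin n)) (M : ℕ)
    (S : ℕ → Finset (Fin N)) (c : ℕ → EuclideanSpace ℝ (Fin N)) : Prop where
  init : S 0 = ∅
  leastSquares : ∀ ℓ ≤ M, IsLeastSquares A y (S ℓ) (c ℓ)
  step : ∀ ℓ < M, ∃ j, IsArgmaxAbs (applyMat A.transpose (y - applyMat A (c ℓ))) j ∧
    S (ℓ + 1) = insert j (S ℓ)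

/-- `OMPReach` exposes only the last state, while the decay argument compares states at different
times. -/
theorem OMPReach.exists_run {A : Matrix (Fin n) (Fin N) ℝ} {y : EuclideanSpace ℝ (Fin n)}
    {M : ℕ} {Λ : Finset (Fin N)} {x : EuclideanSpace ℝ (Fin N)} (h : OMPReach A y M Λ x) :
    ∃ S c, IsOMPRun A y M S c ∧ S M = Λ ∧ c M = x := by
  induction h with
  | init =>
    refine ⟨fun _ => ∅, fun _ => 0, ⟨rfl, fun _ _ => ⟨fun _ _ => rfl, fun z hz => ?_⟩,
      fun ℓ hℓ => absurd hℓ (Nat.not_lt_zero ℓ)⟩, rfl, rfl⟩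
    have : z = 0 := by ext i; exact hz i (by simp)
    rw [this]
  | @step ℓ Λ x x' j _ hj hx' ih =>
    obtain ⟨S, c, hrun, hS, hc⟩ := ih
    refine ⟨fun m => if m ≤ ℓ then S m else insert j Λ, fun m => if m ≤ ℓ then c m else x',
      ⟨by simp [hrun.init], fun m hm => ?_, fun m hm => ?_⟩, by simp, by simp⟩
    · by_cases h : m ≤ ℓ
      · simpa [h] using hrun.leastSquares m h
      · simpa [h] using hx'
    · rcases (Nat.lt_succ_iff.1 hm).lt_or_eq with h | h
      · simpa [h.le, Nat.succ_le_of_lt h] using hrun.step m h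
      · subst h
        exact ⟨j, by simpa [hc] using hj, by simp [hS]⟩

namespace IsOMPRun

variable {A : Matrix (Fin n) (Fin N) ℝ} {y : EuclideanSpace ℝ (Fin n)} {M : ℕ}
  {S : ℕ → Finset (Fin N)} {c : ℕ → EuclideanSpace ℝ (Fin N)}

theorem subset_of_le (h : IsOMPRun A y M S c) {ℓ m : ℕ} (hℓ : ℓ ≤ m) (hm : m ≤ M) :
    S ℓ ⊆ S m := by
  induction m, hℓ using Nat.le_induction with
  | base => exact subset_rfl
  | succ m _ ih =>
    obtain ⟨j, _, hj⟩ := h.step m hm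
    rw [hj]
    exact (ih (by omega)).trans (Finset.subset_insert _ _)

theorem card_le (h : IsOMPRun A y M S c) {ℓ : ℕ} (hℓ : ℓ ≤ M) : (S ℓ).card ≤ ℓ := by
  induction ℓ with
  | zero => simp [h.init]
  | succ ℓ ih =>
    obtain ⟨j, _, hj⟩ := h.step ℓ hℓ
    rw [hj]
    exact (Finset.card_insert_le _ _).trans (Nat.succ_le_succ (ih (by omega)))

theorem residual_anti (h : IsOMPRun A y M S c) {ℓ m : ℕ} (hℓ : ℓ ≤ m) (hm : m ≤ M) :
    ‖y - applyMat A (c m)‖ ^ 2 ≤ ‖y - applyMat A (c ℓ)‖ ^ 2 :=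
  (h.leastSquares ℓ (hℓ.trans hm)).residual_antitone (h.leastSquares m hm)
    (h.subset_of_le hℓ hm)

end IsOMPRun

theorem exp_neg_le_inv : Real.exp (-(15 / 4)) ≤ 1 / 32 := by
  have h1 : (2.6 : ℝ) ^ 15 ≤ Real.exp 1 ^ 15 :=
    pow_le_pow_left₀ (by norm_num) (by linarith [Real.exp_one_gt_d9]) 15
  have h2 : Real.exp 1 ^ 15 = Real.exp (15 / 4) ^ 4 := by
    rw [← Real.exp_nat_mul, ← Real.exp_nat_mul]; norm_num
  have h3 : (32 : ℝ) ≤ Real.exp (15 / 4) := by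
    refine le_of_pow_le_pow_left₀ four_ne_zero (Real.exp_pos _).le ?_
    rw [← h2]
    exact le_trans (by norm_num) h1
  rw [Real.exp_neg, ← one_div]
  exact one_div_le_one_div_of_le (by norm_num) h3

/-- The matrix `A` distorts sparse vectors as the restricted isometry condition allows. -/
structure HasDistortion (A : Matrix (Fin n) (Fin N) ℝ) (k K : ℕ) (δ D U : ℝ) : Prop where
  pos : 0 < D
  upper_pos : 0 < U
  upper_le : U ≤ (1 + δ) * D
  upper : ∀ z, IsSparse k z → ‖applyMat A z‖ ^ 2 ≤ U * ‖z‖ ^ 2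
  lower : ∀ z, IsSparse K z → D * ‖z‖ ^ 2 ≤ ‖applyMat A z‖ ^ 2

/-- The RIP condition rearranges to `1 + dk ≤ (1 + δ) (1 - dα)`, which bounds both `U / D` and `1 /
D` by `1 + δ`. -/
theorem RIPCondition.exists_hasDistortion {A : Matrix (Fin n) (Fin N) ℝ} {k α : ℕ} {δ : ℝ}
    (h : RIPCondition A k α δ) : ∃ D U, 1 ≤ (1 + δ) * D ∧ HasDistortion A k (α * k) δ D U := by
  obtain ⟨dk, dα, ⟨h0, _, hk⟩, ⟨_, h1, hα⟩, hle⟩ := h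
  exact ⟨1 - dα, 1 + dk, by linarith, by linarith, by linarith, by linarith,
    fun z hz => (hk z hz).2, fun z hz => (hα z hz).1⟩

/-- Over `m` iterations with `m` large compared to the number `d` of missing coordinates of `w`,
the excess of the residual energy over that of `w` shrinks by a factor `1 / 32`. -/
theorem IsOMPRun.residual_contract {A : Matrix (Fin n) (Fin N) ℝ}
    {y : EuclideanSpace ℝ (Fin n)} {M : ℕ} {S : ℕ → Finset (Fin N)}
    {c : ℕ → EuclideanSpace ℝ (Fin N)} (hrun : IsOMPRun A y M S c) {k K : ℕ} {δ D U : ℝ}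
    (hA : HasDistortion A k K δ D U) (hδ : 0 < δ) (hk : 1 ≤ k) (hK : M + k ≤ K)
    {T W : Finset (Fin N)} {w : EuclideanSpace ℝ (Fin N)} (hT : T.card ≤ k)
    (hwT : ∀ i, i ∉ T → w i = 0) {ℓ m d : ℕ} (hd : 0 < d) (hℓ : ℓ + m ≤ M)
    (hw : ∀ i, i ∉ S ℓ → i ∉ W → w i = 0) (hW : W.card ≤ d)
    (hm : 15 * (1 + δ) * d ≤ 4 * m) :
    ‖y - applyMat A (c (ℓ + m))‖ ^ 2 ≤
      ‖y - applyMat A w‖ ^ 2 + ‖y - applyMat A (c ℓ)‖ ^ 2 / 32 := by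
  set q := ‖y - applyMat A w‖ ^ 2 with hq
  set ρ : ℕ → ℝ := fun i => ‖y - applyMat A (c i)‖ ^ 2 with hρ
  change ρ (ℓ + m) ≤ q + ρ ℓ / 32
  have hd' : (1 : ℝ) ≤ d := by exact_mod_cast hd
  set θ : ℝ := 1 - 1 / ((1 + δ) * d) with hθ
  have hθ0 : 0 ≤ θ := by
    rw [hθ, sub_nonneg, div_le_one (by positivity)]
    nlinarith
  -- Truncation at 0 covers residuals already below `q`, which stay there by monotonicity.
  have hstep : ∀ i, ℓ ≤ i → i < M → max 0 (ρ (i + 1) - q) ≤ θ * max 0 (ρ i - q) := by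
    intro i hi hiM
    have hanti : ρ (i + 1) ≤ ρ i := hrun.residual_anti (Nat.le_succ i) hiM
    rcases le_total (ρ i) q with hle | hle
    · rw [max_eq_left (by linarith), max_eq_left (by linarith), mul_zero]
    rw [max_eq_right (by linarith : 0 ≤ ρ i - q)]
    refine max_le (mul_nonneg hθ0 (by linarith)) ?_
    obtain ⟨j, hj, hjS⟩ := hrun.step i hiM
    have hLS' := hrun.leastSquares (i + 1) hiM
    rw [hjS] at hLS'
    have hLS := hrun.leastSquares i hiM.le
    classical
    have hcol := hA.upper (EuclideanSpace.single j (1 : ℝ))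
      (isSparse_of_support {j} (fun l hl => by simpa using hl) (by simpa using hk))
    have hlow := hA.lower (w - c i) (isSparse_of_support (T ∪ S i) (fun l hl => by
        rw [Finset.mem_union, not_or] at hl
        simp [hwT l hl.1, hLS.1 l hl.2])
      ((Finset.card_union_le _ _).trans (by have := hrun.card_le hiM.le; omega)))
    have hmain := residual_step (F := W) (d := d) hA.pos hA.upper_pos (by positivity) hlow
      (by simpa using hcol) hLS hj hLS'
      (fun l hl => hw l fun hc => hl (hrun.subset_of_le hi hiM.le hc)) (by exact_mod_cast hW)
    change D * (ρ i - q) ≤ U * d * (ρ i - ρ (i + 1)) at hmain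
    have h1 : D * (ρ i - q) ≤ D * ((1 + δ) * d * (ρ i - ρ (i + 1))) := by
      refine hmain.trans ?_
      have : 0 ≤ d * (ρ i - ρ (i + 1)) := mul_nonneg (by positivity) (by linarith)
      nlinarith [mul_le_mul_of_nonneg_right hA.upper_le this]
    have h2 := le_of_mul_le_mul_left h1 hA.pos
    have h3 : 1 / ((1 + δ) * d) * (ρ i - q) ≤ ρ i - ρ (i + 1) := by
      rw [div_mul_eq_mul_div, one_mul, div_le_iff₀ (by positivity)]
      linarith
    rw [hθ]
    linarith
  have hpow : ∀ i ≤ m, max 0 (ρ (ℓ + i) - q) ≤ θ ^ i * max 0 (ρ ℓ - q) := by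
    intro i
    induction i with
    | zero => intro _; simp
    | succ i ih =>
      intro hi
      refine (hstep (ℓ + i) (by omega) (by omega)).trans ?_
      rw [pow_succ', mul_assoc]
      exact mul_le_mul_of_nonneg_left (ih (by omega)) hθ0
  have hθm : θ ^ m ≤ 1 / 32 := by
    refine le_trans ?_ exp_neg_le_inv
    have h1 : θ ≤ Real.exp (-(1 / ((1 + δ) * d))) := by
      have := Real.add_one_le_exp (-(1 / ((1 + δ) * d)))
      rw [hθ]; linarith
    refine (pow_le_pow_left₀ hθ0 h1 m).trans ?_
    rw [← Real.exp_nat_mul, Real.exp_le_exp, mul_neg, neg_le_neg_iff, mul_one_div,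
      le_div_iff₀ (by positivity)]
    linarith
  have h1 := (le_max_right _ _).trans (hpow m le_rfl)
  have hρ0 : 0 ≤ ρ ℓ := sq_nonneg _
  have hq0 : 0 ≤ q := sq_nonneg _
  have h2 : θ ^ m * max 0 (ρ ℓ - q) ≤ 1 / 32 * ρ ℓ :=
    mul_le_mul hθm (max_le hρ0 (by linarith)) (le_max_left _ _) (by norm_num)
  linarith

/-! ### Dyadic blocks and the capture of missing indices -/

/-- The block lengths `0, 1, 2, 4, 8, …`. -/
def blockSize : ℕ → ℕ
  | 0 => 0
  | j + 1 => 2 ^ j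

/-- The number of iterations spent on the first `j` blocks, at the rate `a`. -/
def blockTime (a : ℕ) : ℕ → ℕ
  | 0 => 0
  | j + 1 => a * (blockSize j + 1)

/-- The increments are `a, a, a, 2a, 4a, …` against block sizes `1, 2, 4, 8, 16, …`. The ratio 4
yields the exponent `15 / 4` and hence the factor `1 / 32`. -/
theorem blockTime_succ (a j : ℕ) :
    ∃ m, blockTime a (j + 1) = blockTime a j + m ∧ a * blockSize (j + 1) ≤ 4 * m := by
  rcases j with _ | _ | j
  · exact ⟨a, by simp [blockTime, blockSize], by simp [blockSize]; omega⟩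
  · exact ⟨a, by simp [blockTime, blockSize]; ring, by simp [blockSize]; omega⟩
  · exact ⟨a * 2 ^ j, by simp [blockTime, blockSize, pow_succ]; ring,
      by simp [blockSize, pow_succ]; linarith⟩

theorem blockSize_strictMono : StrictMono blockSize :=
  strictMono_nat_of_lt_succ fun j => by
    rcases j with _ | j
    · simp [blockSize]
    · simp [blockSize, pow_succ]

theorem blockTime_mono (a : ℕ) : Monotone (blockTime a) :=
  monotone_nat_of_le_succ fun j => by
    obtain ⟨m, hm, _⟩ := blockTime_succ a j
    omega

/-- A set of at most `d` indices in `G` whose removal leaves the least energy. -/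
theorem exists_min_tail (z : EuclideanSpace ℝ (Fin N)) (G : Finset (Fin N)) (d : ℕ) :
    ∃ W ⊆ G, W.card ≤ d ∧ ∀ W' ⊆ G, W'.card ≤ d →
      ∑ i ∈ G \ W, z i ^ 2 ≤ ∑ i ∈ G \ W', z i ^ 2 := by
  obtain ⟨W, hW, hmin⟩ := Finset.exists_min_image (G.powerset.filter fun W => W.card ≤ d)
    (fun W => ∑ i ∈ G \ W, z i ^ 2) ⟨∅, by simp⟩
  simp only [Finset.mem_filter, Finset.mem_powerset] at hW hmin
  exact ⟨W, hW.1, hW.2, fun W' h1 h2 => hmin W' ⟨h1, h2⟩⟩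

theorem norm_add_sq_le_two_mul {E : Type*} [NormedAddCommGroup E] (u v : E) :
    ‖u + v‖ ^ 2 ≤ 2 * ‖u‖ ^ 2 + 2 * ‖v‖ ^ 2 := by
  have h := pow_le_pow_left₀ (norm_nonneg _) (norm_add_le u v) 2
  nlinarith [sq_nonneg (‖u‖ - ‖v‖)]

theorem add_sq_lt_of_residual_large {δ R η X : ℝ} (hδ₀ : 0 < δ) (hδ₁ : δ ≤ 1)
    (hX : 4 * (R ^ 2 - 64 / 31 * η ^ 2) ≤ (1 + δ) * X)
    (hR : (11 + 20 * δ) * η ^ 2 < R ^ 2) : (R + η) ^ 2 < X := by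
  have h1 : (R + η) ^ 2 ≤ 5 / 4 * R ^ 2 + 5 * η ^ 2 := by nlinarith [sq_nonneg (R / 2 - 2 * η)]
  have h2 : (1 + δ) * (5 / 4 * R ^ 2 + 5 * η ^ 2) < 4 * (R ^ 2 - 64 / 31 * η ^ 2) := by
    have h3 : (4 - 5 / 4 * (1 + δ)) * ((11 + 20 * δ) * η ^ 2) < (4 - 5 / 4 * (1 + δ)) * R ^ 2 :=
      mul_lt_mul_of_pos_left hR (by linarith)
    have h4 : 0 ≤ ((4 - 5 / 4 * (1 + δ)) * (11 + 20 * δ) - 256 / 31 - 5 * (1 + δ)) * η ^ 2 :=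
      mul_nonneg (by nlinarith) (sq_nonneg _)
    linarith
  have h5 : (1 + δ) * (R + η) ^ 2 < (1 + δ) * X :=
    lt_of_le_of_lt (mul_le_mul_of_nonneg_left h1 (by linarith)) (h2.trans_le hX)
  exact lt_of_mul_lt_mul_left h5 (by linarith)

/-- Either the residual is small, or a run of `a * b` further iterations selects at least `b` of
the missing indices of the support of `z`. -/
theorem IsOMPRun.residual_small_or_capture {A : Matrix (Fin n) (Fin N) ℝ}
    {y : EuclideanSpace ℝ (Fin n)} {M : ℕ} {S : ℕ → Finset (Fin N)}
    {c : ℕ → EuclideanSpace ℝ (Fin N)} (hrun : IsOMPRun A y M S c) {k a : ℕ} {δ D U : ℝ}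
    (hA : HasDistortion A k (M + k) δ D U) (hδ₀ : 0 < δ) (hδ₁ : δ ≤ 1)
    (ha : 15 * (1 + δ) ≤ a) {T : Finset (Fin N)} {z : EuclideanSpace ℝ (Fin N)}
    (hT : T.card ≤ k) (hzT : ∀ i, i ∉ T → z i = 0) {e : EuclideanSpace ℝ (Fin n)}
    (hy : y = applyMat A z + e) {ℓ : ℕ} (hpos : 0 < (T \ S ℓ).card)
    (hℓ : ℓ + a * (T \ S ℓ).card ≤ M) :
    ∃ b, 0 < b ∧ b ≤ (T \ S ℓ).card ∧
      (‖y - applyMat A (c (ℓ + a * b))‖ ^ 2 ≤ (11 + 20 * δ) * ‖e‖ ^ 2 ∨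
        (T \ S (ℓ + a * b)).card + b ≤ (T \ S ℓ).card) := by
  have hk : 1 ≤ k := hpos.trans_le ((Finset.card_le_card Finset.sdiff_subset).trans hT)
  have hℓM : ℓ ≤ M := (Nat.le_add_right _ _).trans hℓ
  set G := T \ S ℓ with hG
  choose W hWG hWcard hWmin using exists_min_tail z G
  set τ : ℕ → ℝ := fun j => ∑ i ∈ G \ W (blockSize j), z i ^ 2 with hτ
  have hτ0 : ∀ j, 0 ≤ τ j := fun j => Finset.sum_nonneg fun _ _ => sq_nonneg _
  have hτfull : ∀ j, G.card ≤ blockSize j → τ j = 0 := fun j hj =>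
    le_antisymm ((hWmin _ G subset_rfl hj).trans (by simp)) (hτ0 j)
  set w : ℕ → EuclideanSpace ℝ (Fin N) := fun j =>
    restrictTo ((T ∩ S ℓ) ∪ W (blockSize j)) z with hw
  have hwT : ∀ j i, i ∉ T → w j i = 0 := fun j i hi => by
    simp [hw, restrictTo_apply, hzT i hi]
  have hwS : ∀ j i, i ∉ S ℓ → i ∉ W (blockSize j) → w j i = 0 := fun j i h1 h2 => by
    simp [hw, restrictTo_apply, h1, h2]
  have hz_sub : ∀ j, ‖z - w j‖ ^ 2 = τ j := fun j => by
    rw [norm_sq_eq_sum_of_support (G \ W (blockSize j))]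
    · refine Finset.sum_congr rfl fun i hi => ?_
      rw [hG, Finset.mem_sdiff, Finset.mem_sdiff] at hi
      simp [hw, restrictTo_apply, hi.1.2, hi.2]
    · intro i hi
      by_cases hiT : i ∈ T
      · have : (i ∈ T ∧ i ∈ S ℓ) ∨ i ∈ W (blockSize j) := by
          rw [hG, Finset.mem_sdiff, Finset.mem_sdiff] at hi
          tauto
        simp [hw, restrictTo_apply, this]
      · simp [hwT j i hiT, hzT i hiT]
  have hq : ∀ j, ‖y - applyMat A (w j)‖ ^ 2 ≤ 2 * U * τ j + 2 * ‖e‖ ^ 2 := fun j => by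
    have h1 : y - applyMat A (w j) = applyMat A (z - w j) + e := by
      rw [hy, applyMat_sub]; abel
    have h2 := hA.upper (z - w j)
      (isSparse_of_support T (fun i hi => by simp [hwT j i hi, hzT i hi]) hT)
    rw [hz_sub] at h2
    rw [h1]
    linarith [norm_add_sq_le_two_mul (applyMat A (z - w j)) e]
  set ρ : ℕ → ℝ := fun i => ‖y - applyMat A (c i)‖ ^ 2 with hρ
  have hcontract : ∀ j, ℓ + blockTime a (j + 1) ≤ M →
      ρ (ℓ + blockTime a (j + 1)) ≤
        2 * U * τ (j + 1) + 2 * ‖e‖ ^ 2 + ρ (ℓ + blockTime a j) / 32 := by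
    intro j hj
    obtain ⟨m, hm, ham⟩ := blockTime_succ a j
    rw [hm, ← add_assoc] at hj ⊢
    have hmono := hrun.subset_of_le (Nat.le_add_right ℓ (blockTime a j))
      ((Nat.le_add_right _ _).trans hj)
    have ham' : (a : ℝ) * blockSize (j + 1) ≤ 4 * m := by exact_mod_cast ham
    refine (hrun.residual_contract (w := w (j + 1)) (W := W (blockSize (j + 1))) hA hδ₀ hk
      le_rfl hT (hwT _) (d := blockSize (j + 1)) (by simp [blockSize]) hj
      (fun i hi => hwS _ i fun hc => hi (hmono hc)) (hWcard _)
      ((mul_le_mul_of_nonneg_right ha (Nat.cast_nonneg _)).trans ham')).trans ?_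
    linarith [hq (j + 1)]
  -- The tail vanishes once the block size reaches `G.card`.
  have hex : ∃ j, 16 * τ (j + 1) ≤ τ j := by
    refine ⟨G.card, ?_⟩
    rw [hτfull (G.card + 1) ((Nat.le_succ _).trans (blockSize_strictMono.id_le _)), mul_zero]
    exact hτ0 _
  classical
  set L := Nat.find hex with hL
  have hLspec : 16 * τ (L + 1) ≤ τ L := Nat.find_spec hex
  have hLmin : ∀ j < L, τ j < 16 * τ (j + 1) := fun j hj => not_le.1 (Nat.find_min hex hj)
  have hLcard : blockSize L < G.card := by
    by_contra! hcon
    rcases hL0 : L with _ | j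
    · rw [hL0] at hcon
      simp only [blockSize] at hcon
      omega
    · have h1 := hLmin j (by omega)
      rw [← hL0, hτfull L hcon, mul_zero] at h1
      exact absurd h1 (not_lt.2 (hτ0 j))
  have htime : ℓ + blockTime a (L + 1) ≤ M := by
    refine le_trans ?_ hℓ
    exact Nat.add_le_add_left (Nat.mul_le_mul_left a hLcard) ℓ
  -- Before `L` tails shrink by less than 16, so `2 + 4 * 16 / 32 = 4` reproduces itself; `64 / 31`
  -- is the fixed point of `s = 2 + s / 32`.
  have hbound : ∀ j ≤ L, ρ (ℓ + blockTime a j) ≤ 4 * U * τ j + 64 / 31 * ‖e‖ ^ 2 := by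
    intro j
    induction j with
    | zero =>
      intro _
      have h1 : ρ ℓ ≤ ‖y - applyMat A (w 0)‖ ^ 2 :=
        pow_le_pow_left₀ (norm_nonneg _) ((hrun.leastSquares ℓ hℓM).2 _ fun i hi =>
          hwS 0 i hi (by
            have h0 : W (blockSize 0) = ∅ :=
              Finset.card_eq_zero.1 (Nat.le_zero.1 (hWcard (blockSize 0)))
            simp [h0])) 2
      have h2 := mul_nonneg hA.upper_pos.le (hτ0 0)
      have h3 := sq_nonneg ‖e‖
      simp only [blockTime, add_zero]
      linarith [hq 0]
    | succ j ih =>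
      intro hj
      have h1 := hcontract j
        ((Nat.add_le_add_left (blockTime_mono a (hj.trans (Nat.le_succ _))) ℓ).trans htime)
      have h2 := ih (by omega)
      have h3 := mul_le_mul_of_nonneg_left (hLmin j (by omega)).le hA.upper_pos.le
      linarith
  -- The new tail and the old residual contribute `U * τ L / 8` each.
  have hfinal : ρ (ℓ + blockTime a (L + 1)) ≤ U * τ L / 4 + 64 / 31 * ‖e‖ ^ 2 := by
    have h1 := hcontract L htime
    have h2 := hbound L le_rfl
    have h3 := mul_le_mul_of_nonneg_left hLspec hA.upper_pos.le
    linarith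
  refine ⟨blockSize L + 1, Nat.succ_pos _, hLcard, ?_⟩
  change ρ (ℓ + blockTime a (L + 1)) ≤ _ ∨ (T \ S (ℓ + blockTime a (L + 1))).card + _ ≤ _
  set ℓ' := ℓ + blockTime a (L + 1) with hℓ'
  by_cases hsmall : ρ ℓ' ≤ (11 + 20 * δ) * ‖e‖ ^ 2
  · exact Or.inl hsmall
  right
  push Not at hsmall
  have hSS : S ℓ ⊆ S ℓ' := hrun.subset_of_le (Nat.le_add_right _ _) htime
  have hLS := hrun.leastSquares ℓ' htime
  have hgap : (‖y - applyMat A (c ℓ')‖ + ‖e‖) ^ 2 < D * τ L := by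
    refine add_sq_lt_of_residual_large hδ₀ hδ₁ ?_ hsmall
    have h1 := mul_le_mul_of_nonneg_right hA.upper_le (hτ0 L)
    change 4 * (ρ ℓ' - _) ≤ _
    linarith
  have herr : D * ‖z - c ℓ'‖ ^ 2 ≤ (‖y - applyMat A (c ℓ')‖ + ‖e‖) ^ 2 := by
    refine (hA.lower _ (isSparse_of_support (T ∪ S ℓ') (fun i hi => ?_) ?_)).trans
      (pow_le_pow_left₀ (norm_nonneg _) ?_ 2)
    · rw [Finset.mem_union, not_or] at hi
      simp [hzT i hi.1, hLS.1 i hi.2]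
    · exact (Finset.card_union_le _ _).trans (by have := hrun.card_le htime; omega)
    · have h1 : applyMat A (z - c ℓ') = (y - applyMat A (c ℓ')) - e := by
        rw [hy, applyMat_sub]; abel
      rw [h1]
      exact norm_sub_le _ _
  have htail : ∑ i ∈ G \ S ℓ', z i ^ 2 < τ L := by
    refine lt_of_mul_lt_mul_left (lt_of_le_of_lt ?_ (herr.trans_lt hgap)) hA.pos.le
    refine mul_le_mul_of_nonneg_left (le_trans (le_of_eq ?_)
      (sum_sq_le_norm_sq (G \ S ℓ') (z - c ℓ'))) hA.pos.le
    refine Finset.sum_congr rfl fun i hi => ?_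
    simp [hLS.1 i (Finset.mem_sdiff.1 hi).2]
  -- Capturing at most `blockSize L` indices would leave energy at least `τ L`, the minimal tail.
  have hcap : blockSize L < (G ∩ S ℓ').card := by
    by_contra! hcon
    have h1 := hWmin (blockSize L) (G ∩ S ℓ') Finset.inter_subset_left hcon
    rw [Finset.sdiff_inter_self_left] at h1
    exact absurd htail (not_lt.2 h1)
  have hTG : T \ S ℓ' = G \ S ℓ' := by
    rw [hG, sdiff_sdiff_left, Finset.sup_eq_union, Finset.union_eq_right.2 hSS]
  have hsplit := Finset.card_sdiff_add_card_inter G (S ℓ')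
  rw [hTG]
  omega

/-! ### Induction on the missing indices and the error bound -/

/-- After `a` iterations per missing index, the residual is comparable to the noise `e`. -/
theorem IsOMPRun.residual_le {A : Matrix (Fin n) (Fin N) ℝ}
    {y : EuclideanSpace ℝ (Fin n)} {M : ℕ} {S : ℕ → Finset (Fin N)}
    {c : ℕ → EuclideanSpace ℝ (Fin N)} (hrun : IsOMPRun A y M S c) {k a : ℕ} {δ D U : ℝ}
    (hA : HasDistortion A k (M + k) δ D U) (hδ₀ : 0 < δ) (hδ₁ : δ ≤ 1)
    (ha : 15 * (1 + δ) ≤ a) {T : Finset (Fin N)} {z : EuclideanSpace ℝ (Fin N)}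
    (hT : T.card ≤ k) (hzT : ∀ i, i ∉ T → z i = 0) {e : EuclideanSpace ℝ (Fin n)}
    (hy : y = applyMat A z + e) (ℓ : ℕ) (hℓ : ℓ + a * (T \ S ℓ).card ≤ M) :
    ‖y - applyMat A (c M)‖ ^ 2 ≤ (11 + 20 * δ) * ‖e‖ ^ 2 := by
  induction hK : (T \ S ℓ).card using Nat.strong_induction_on generalizing ℓ with
  | _ K ih =>
    subst hK
    rcases Nat.eq_zero_or_pos (T \ S ℓ).card with h0 | hpos
    · rw [h0, mul_zero, add_zero] at hℓ
      have hTS : T ⊆ S ℓ := Finset.sdiff_eq_empty_iff_subset.1 (Finset.card_eq_zero.1 h0)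
      have h1 := pow_le_pow_left₀ (norm_nonneg _)
        ((hrun.leastSquares ℓ hℓ).2 z fun i hi => hzT i fun hc => hi (hTS hc)) 2
      rw [show y - applyMat A z = e by rw [hy]; abel] at h1
      refine (hrun.residual_anti hℓ le_rfl).trans (h1.trans ?_)
      nlinarith [sq_nonneg ‖e‖]
    · obtain ⟨b, hb, hbK, h | h⟩ :=
        hrun.residual_small_or_capture hA hδ₀ hδ₁ ha hT hzT hy hpos hℓ
      · refine (hrun.residual_anti ?_ le_rfl).trans h
        exact (Nat.add_le_add_left (Nat.mul_le_mul_left a hbK) ℓ).trans hℓ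
      -- The `a * b` iterations spent are paid for by the `b` captured indices.
      · refine ih _ (by omega) (ℓ + a * b) ?_ rfl
        have := Nat.mul_le_mul_left a h
        rw [mul_add] at this
        omega

/-- The error of orthogonal matching pursuit against a `k`-sparse vector `z`. -/
theorem RIPCondition.norm_output_sub_le {A : Matrix (Fin n) (Fin N) ℝ} {k α : ℕ} {δ : ℝ}
    (h : RIPCondition A k α δ) (hδ₀ : 0 < δ) (hδ₁ : δ ≤ 1) (hα : 16 + 15 * δ ≤ α)
    {T : Finset (Fin N)} {z : EuclideanSpace ℝ (Fin N)}
    (hT : T.card ≤ k) (hzT : ∀ i, i ∉ T → z i = 0) {y e : EuclideanSpace ℝ (Fin n)}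
    (hy : y = applyMat A z + e) {xs : EuclideanSpace ℝ (Fin N)}
    (hxs : IsOMPOutput A ((α - 1) * k) y xs) :
    ‖xs - z‖ ≤ √(1 + δ) * (1 + √(11 + 20 * δ)) * ‖e‖ := by
  obtain ⟨Λ, hreach⟩ := hxs
  obtain ⟨S, c, hrun, -, rfl⟩ := hreach.exists_run
  obtain ⟨D, U, hD, hA⟩ := h.exists_hasDistortion
  obtain ⟨a, rfl⟩ : ∃ a, α = a + 1 := by
    rcases α with _ | a
    · norm_num at hα; linarith
    · exact ⟨a, rfl⟩
  have ha : 15 * (1 + δ) ≤ a := by push_cast at hα; linarith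
  rw [add_mul, one_mul] at hA
  simp only [Nat.add_sub_cancel] at hrun ⊢
  set M := a * k
  have hres := hrun.residual_le hA hδ₀ hδ₁ ha hT hzT hy 0 (by
    rw [zero_add]
    exact Nat.mul_le_mul_left a ((Finset.card_le_card Finset.sdiff_subset).trans hT))
  have hr : ‖y - applyMat A (c M)‖ ≤ √(11 + 20 * δ) * ‖e‖ := by
    rw [← Real.sqrt_sq (norm_nonneg e), ← Real.sqrt_mul (by linarith)]
    exact Real.le_sqrt_of_sq_le hres
  have hLS := hrun.leastSquares M le_rfl
  have hlow := hA.lower (c M - z) (isSparse_of_support (S M ∪ T) (fun i hi => by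
      rw [Finset.mem_union, not_or] at hi
      simp [hzT i hi.2, hLS.1 i hi.1])
    ((Finset.card_union_le _ _).trans (Nat.add_le_add (hrun.card_le le_rfl) hT)))
  have hnorm : ‖applyMat A (c M - z)‖ ≤ (1 + √(11 + 20 * δ)) * ‖e‖ := by
    have h1 : applyMat A (c M - z) = e - (y - applyMat A (c M)) := by
      rw [hy, applyMat_sub]; abel
    rw [h1]
    linarith [norm_sub_le e (y - applyMat A (c M))]
  have hsq : ‖c M - z‖ ^ 2 ≤ (1 + δ) * ((1 + √(11 + 20 * δ)) * ‖e‖) ^ 2 := by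
    have h1 := mul_le_mul_of_nonneg_left
      (hlow.trans (pow_le_pow_left₀ (norm_nonneg _) hnorm 2)) (by linarith : 0 ≤ 1 + δ)
    have h2 := mul_le_mul_of_nonneg_right hD (sq_nonneg ‖c M - z‖)
    linarith
  have h3 := Real.le_sqrt_of_sq_le hsq
  rwa [Real.sqrt_mul (by linarith), Real.sqrt_sq (by positivity), ← mul_assoc] at h3

end OMP

/-! ### Instance optimality in probability -/

theorem one_sub_two_mul_le_measureReal_inter {Ω : Type*} [MeasurableSpace Ω]
    (P : MeasureTheory.Measure Ω) [MeasureTheory.IsProbabilityMeasure P] {s t : Set Ω} {ε : ℝ}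
    (ht : MeasurableSet t) (hs' : 1 - ε ≤ P.real s) (ht' : 1 - ε ≤ P.real t) :
    1 - 2 * ε ≤ P.real (s ∩ t) := by
  have h1 := MeasureTheory.measureReal_union_add_inter (μ := P) (s := s) ht
  have h2 : P.real (s ∪ t) ≤ 1 := MeasureTheory.measureReal_le_one
  linarith

theorem theorem2 {Ω : Type*} [MeasurableSpace Ω] (P : MeasureTheory.Measure Ω)
    [MeasureTheory.IsProbabilityMeasure P] (n N k : ℕ)
    (Φ : Ω → Matrix (Fin n) (Fin N) ℝ)
    (δ ε C : ℝ) (hδ₀ : 0 < δ) (hδ₁ : δ ≤ 1)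
    (α : ℕ) (hα : α = ⌈16 + 15 * δ⌉₊)
    (hRIP : RIPConditionWithProb P Φ k α δ ε)
    (hbdd : BoundednessWithProb P Φ C ε)
    (x : EuclideanSpace ℝ (Fin N)) :
    ∃ Ωx : Set Ω, MeasurableSet Ωx ∧ 1 - 2 * ε ≤ P.real Ωx ∧
      ∀ ω ∈ Ωx, ∀ xs : EuclideanSpace ℝ (Fin N),
        IsOMPOutput (Φ ω) ((α - 1) * k) (applyMat (Φ ω) x) xs →
          ‖xs - x‖ ≤
            (1 + √(C * (1 + δ)) * (1 + √(11 + 20 * δ))) * bestTermError k x := by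
  obtain ⟨T, z, hT, hzT, hz⟩ := exists_best_term_approx k x
  obtain ⟨Ω₀, hm₀, hP₀, hΩ₀⟩ := hRIP
  obtain ⟨Ω₁, hm₁, hP₁, hΩ₁⟩ := hbdd (x - z)
  refine ⟨Ω₀ ∩ Ω₁, hm₀.inter hm₁, one_sub_two_mul_le_measureReal_inter P hm₁ hP₀ hP₁, ?_⟩
  rintro ω ⟨h₀, h₁⟩ xs hxs
  have hα' : 16 + 15 * δ ≤ α := hα ▸ Nat.le_ceil _
  have herr := (hΩ₀ ω h₀).norm_output_sub_le hδ₀ hδ₁ hα' hT hzT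
    (e := applyMat (Φ ω) (x - z)) (by rw [applyMat_sub]; abel) hxs
  have he : ‖applyMat (Φ ω) (x - z)‖ ≤ √C * ‖x - z‖ := by
    -- The sign of `C` is unknown, so the root is split using nonnegativity of the other factor.
    have h2 := Real.le_sqrt_of_sq_le (hΩ₁ ω h₁)
    rwa [mul_comm, Real.sqrt_mul (sq_nonneg _), Real.sqrt_sq (norm_nonneg _), mul_comm] at h2
  have htri : ‖xs - x‖ ≤ ‖xs - z‖ + ‖x - z‖ := by
    rw [← norm_neg (x - z), neg_sub]
    simpa using norm_add_le (xs - z) (z - x)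
  rw [mul_comm C, Real.sqrt_mul (by linarith)]
  calc ‖xs - x‖ ≤ √(1 + δ) * (1 + √(11 + 20 * δ)) * (√C * ‖x - z‖) + ‖x - z‖ := by
        refine htri.trans (add_le_add_left (herr.trans ?_) _)
        exact mul_le_mul_of_nonneg_left he (by positivity)
    _ = (1 + √(1 + δ) * √C * (1 + √(11 + 20 * δ))) * ‖x - z‖ := by ring
    _ ≤ _ := mul_le_mul_of_nonneg_left hz (by positivity)
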